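/- We work in classical mathematics (where the axiom BDD, "every bar descends from a decidable bar", holds). Definitions. A pre-natural space is a countably infinite set $V$ of basic dots with a partial order $\preceq$ (refinement) and a symmetric, irreflexive relation $\#$ (pre-apartness), both decidable, such that $a\preceq b$ and $c\mathrel\# b$ imply $c\mathrel\# a$; $\prec$ denotes strict refinement. A point is a sequence $p=(p_n)_{n\in\mathbb N}$ in $V$ with $p_{n+1}\preceq p_n$ for all $n$, such that for every $n$ there is $m$ with $p_m\prec p_n$, and such that whenever $a\mathrel\# b$ there is $m$ with $p_m\mathrel\# a$ or $p_m\mathrel\# b$. Let $\mathcal V$ be the set of points. For points, $p\mathrel\# q$ means $p_n\mathrel\# q_n$ for some $n$, and $p\equiv q$ means $\neg(p\mathrel\# q)$; $\hat a=\{p\in\mathcal V : p_m\prec a \text{ for some } m\}$. A set $U\subseteq\mathcal V$ is open iff for all $x\in U$ and $y\in\mathcal V$, either $y\mathrel\# x$ or $\hat{y_m}\subseteq U$ for some $m$. The space is a natural space if $V$ has a maximal dot $\top$ (that is, $a\preceq\top$ for all $a\in V$) and $\hat a\neq\emptyset$ for every $a\in V$. A refinement morphism from $V$ to a natural space $W$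 is a map $g:V\to W$ of basic dots that preserves $\preceq$, sends every point $p$ of $V$ to a point $g(p)=(g(p_n))_n$ of $W$, and satisfies: $g(p)\mathrel\# g(q)$ implies $p\mathrel\# q$, for all points $p,q$ of $V$. The dot $a$ is a successor of $c$ if $a\prec c$ and no dot lies strictly between them. A natural space $V$ is a spraid if every $a\in V$ has only finitely many $b$ with $a\preceq b$; for every $a\in V$ all finite sequences from $\top$ to $a$ in which each term is a successor of the preceding one have the same length; and every infinite sequence $p_0\succ p_1\succ\cdots$ in $V$ is a point. The natural reals are the points of the natural space whose dots are the whole line $(-\infty,\infty)$ (the maximal dot) and the intervals $[p,q]$ with $p<q$ rational, where $\preceq$ is inclusion and $\#$ is disjointness. The natural space $\sigma_{\mathbb R}$ has as dots $(-\infty,\infty)$ and the intervals $[\frac n{2^m},\frac{n+2}{2^m}]$ with $n\in\mathbb Z$, $m\in\mathbb N$, with the same relations; its points are natural reals. Theorem. Let $V$ be a spraid, with set of points $\mathcal V$, and let $f$ be a continuous function from $\mathcal V$ to the natural reals. Then there is a refinement morphism $g$ from $V$ to $\sigma_{\mathbb R}$ such that $f(x)\equiv g(x)$, as natural reals, for all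 $x\in\mathcal V$. -/

import Mathlib

namespace NTop

universe u v

/-! ### Pre-natural spaces and their points -/

/-- A pre-natural space: a countably infinite set `V` of basic dots with a decidable pre-apartness
`apart` and a decidable refinement order `≤` (`a ≤ b` says that `a` refines `b`; the strict
refinement `a ≺ b` is `a < b`). -/
class PreNaturalSpace (V : Type u) extends PartialOrder V where
  countable : Nonempty (ℕ ≃ V)
  apart : V → V → Prop
  decidableApart : DecidableRel apart
  decidableRefines : DecidableRel (fun a b : V => a ≤ b)
  apart_symm : ∀ a b, apart a b ↔ apart b a
  apart_irrefl : ∀ a, ¬ apart a a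
  apart_mono : ∀ a b c, a ≤ b → apart c b → apart c a

/-- A sequence of basic dots is a point if it is shrinking, strictly infinitely often, and chooses
between any two dots that lie apart. -/
structure IsPoint {V : Type u} [PreNaturalSpace V] (p : ℕ → V) : Prop where
  shrinking : ∀ n, p (n + 1) ≤ p n
  strict : ∀ n, ∃ m, p m < p n
  decides : ∀ a b, PreNaturalSpace.apart a b →
    ∃ m, PreNaturalSpace.apart (p m) a ∨ PreNaturalSpace.apart (p m) b

/-- The set of points of a pre-natural space. -/
def Point (V : Type u) [PreNaturalSpace V] : Type u := {p : ℕ → V // IsPoint p}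

namespace Point

variable {V : Type u} [PreNaturalSpace V]

/-- Two points are apart if their dots are apart at some index. -/
def Apart (p q : Point V) : Prop := ∃ n, PreNaturalSpace.apart (p.1 n) (q.1 n)

/-- Equivalence of points: not apart. -/
def Equiv (p q : Point V) : Prop := ¬ Apart p q

/-- `p` belongs to the dot `a` (`a` is a beginning of `p`). -/
def BelongsTo (p : Point V) (a : V) : Prop := ∃ m, p.1 m < a

/-- The set of all points that belong to the dot `a`. -/
def hat (a : V) : Set (Point V) := {p | p.BelongsTo a}

theorem hat_mono {a b : V} (h : a ≤ b) : hat a ⊆ hat b :=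
  fun _ ⟨m, hm⟩ => ⟨m, lt_of_lt_of_le hm h⟩

theorem le_of_le (p : Point V) {m n : ℕ} (h : m ≤ n) : p.1 n ≤ p.1 m :=
  antitone_nat_of_succ_le p.2.shrinking h

/-- The apartness topology: `U` is open if for all `x ∈ U` and all points `y`, either `y` is apart
from `x`, or all points that belong to some dot `y m` of `y` lie in `U`. -/
instance : TopologicalSpace (Point V) where
  IsOpen U := ∀ x ∈ U, ∀ y : Point V, Apart y x ∨ ∃ m, hat (y.1 m) ⊆ U
  isOpen_univ := fun _ _ _ => Or.inr ⟨0, Set.subset_univ _⟩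
  isOpen_inter := by
    intro s t hs ht x hx y
    rcases hs x hx.1 y with h | ⟨m, hm⟩
    · exact Or.inl h
    rcases ht x hx.2 y with h | ⟨k, hk⟩
    · exact Or.inl h
    exact Or.inr ⟨max m k, Set.subset_inter
      ((hat_mono (y.le_of_le (le_max_left m k))).trans hm)
      ((hat_mono (y.le_of_le (le_max_right m k))).trans hk)⟩
  isOpen_sUnion := by
    rintro S hS x ⟨U, hU, hx⟩ y
    rcases hS U hU x hx y with h | ⟨m, hm⟩
    · exact Or.inl h
    · exact Or.inr ⟨m, hm.trans (Set.subset_sUnion_of_mem hU)⟩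

end Point

/-! ### Natural spaces, morphisms, spraids -/

/-- A natural space: a pre-natural space with a maximal dot `⊤` in which every dot contains a
point. -/
class NaturalSpace (V : Type u) extends PreNaturalSpace V, OrderTop V where
  exists_point : ∀ a : V, ∃ p : Point V, p.BelongsTo a

/-- A refinement morphism: a map of basic dots that sends points to points, reflects apartness of
points, and respects refinement. -/
structure RefinementMorphism (V : Type u) (W : Type v) [NaturalSpace V] [NaturalSpace W] where
  toFun : V → W
  map_isPoint : ∀ p : Point V, IsPoint (fun n => toFun (p.1 n))
  apart_of_map_apart : ∀ p q : Point V,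
    Point.Apart (⟨_, map_isPoint p⟩ : Point W) ⟨_, map_isPoint q⟩ → Point.Apart p q
  map_le : ∀ a b : V, a ≤ b → toFun a ≤ toFun b

/-- The induced function on points, `g(p) = g(p 0), g(p 1), …`. -/
def RefinementMorphism.onPoints {V : Type u} {W : Type v} [NaturalSpace V] [NaturalSpace W]
    (g : RefinementMorphism V W) (p : Point V) : Point W :=
  ⟨fun n => g.toFun (p.1 n), g.map_isPoint p⟩

/-- The refinement order of `V` is a trea: every dot has finitely many predecessors, and all
successor-trails `⊤ = b 0, b 1, …, b n = a` from the maximal dot to `a` have the same length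
`grd a`. Here `a ⋖ c` says that `a` is an (immediate) successor of `c`. -/
structure IsTrea (V : Type u) [NaturalSpace V] : Prop where
  finite_predecessors : ∀ a : V, {b : V | a ≤ b}.Finite
  graded : ∃ grd : V → ℕ, ∀ (n : ℕ) (b : ℕ → V),
    b 0 = ⊤ → (∀ i < n, b (i + 1) ⋖ b i) → n = grd (b n)

/-- A spraid: the refinement order is a trea and each infinite strictly refining trail of dots is a
point. -/
structure IsSpraid (V : Type u) [NaturalSpace V] : Prop where
  trea : IsTrea V
  isPoint_of_trail : ∀ p : ℕ → V, (∀ n, p (n + 1) < p n) → IsPoint p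

/-! ### The natural real numbers -/

/-- The basic dots of the natural reals: the closed rational intervals `[p, q]` with `p < q`, and
the whole line. -/
inductive RatInterval : Type
  | whole : RatInterval
  | Icc (p q : ℚ) (h : p < q) : RatInterval

namespace RatInterval

/-- `[a, b]` refines `[c, d]` iff `c ≤ a` and `b ≤ d`; everything refines the whole line. -/
def Refines : RatInterval → RatInterval → Prop
  | _, whole => True
  | whole, Icc _ _ _ => False
  | Icc a b _, Icc c d _ => c ≤ a ∧ b ≤ d

/-- `[a, b]` is apart from `[c, d]` iff `d < a` or `b < c`; nothing is apart from the whole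
line. -/
def Apart : RatInterval → RatInterval → Prop
  | Icc a b _, Icc c d _ => d < a ∨ b < c
  | whole, _ => False
  | Icc _ _ _, whole => False

instance : DecidableRel Refines
  | whole, whole => .isTrue trivial
  | Icc _ _ _, whole => .isTrue trivial
  | whole, Icc _ _ _ => .isFalse id
  | Icc a b _, Icc c d _ => inferInstanceAs (Decidable (c ≤ a ∧ b ≤ d))

instance : DecidableRel Apart
  | Icc a b _, Icc c d _ => inferInstanceAs (Decidable (d < a ∨ b < c))
  | whole, _ => .isFalse id
  | Icc _ _ _, whole => .isFalse id

theorem denumerable : Nonempty (ℕ ≃ RatInterval) := by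
  have hc : Countable RatInterval := by
    let e : RatInterval → Option (ℚ × ℚ) := fun a => match a with
      | whole => none
      | Icc p q _ => some (p, q)
    refine Function.Injective.countable (f := e) ?_
    rintro (_ | ⟨p, q, h⟩) (_ | ⟨p', q', h'⟩) hab <;> simp_all [e]
  have hi : Infinite RatInterval := by
    refine Infinite.of_injective
      (fun n : ℕ => Icc 0 ((n : ℚ) + 1) (by positivity)) ?_
    intro m n h
    simpa using h
  exact (nonempty_denumerable RatInterval).elim fun d => ⟨(Denumerable.eqv RatInterval).symm⟩

instance : PreNaturalSpace RatInterval where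
  le := Refines
  le_refl := by rintro (_ | _) <;> simp [Refines]
  le_trans := by
    rintro (_ | _) (_ | _) (_ | _) <;> simp only [Refines] <;> try tauto
    rintro ⟨h1, h2⟩ ⟨h3, h4⟩
    exact ⟨h3.trans h1, h2.trans h4⟩
  le_antisymm := by
    rintro (_ | _) (_ | _) <;> simp only [Refines] <;> try tauto
    rintro ⟨h1, h2⟩ ⟨h3, h4⟩
    have := le_antisymm h1 h3
    have := le_antisymm h2 h4
    subst_vars
    rfl
  countable := denumerable
  apart := Apart
  decidableApart := inferInstance
  decidableRefines := inferInstanceAs (DecidableRel Refines)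
  apart_symm := by rintro (_ | _) (_ | _) <;> simp only [Apart] <;> tauto
  apart_irrefl := by
    rintro (_ | ⟨p, q, h⟩)
    · simp [Apart]
    · simp only [Apart, not_or, not_lt]; exact ⟨h.le, h.le⟩
  apart_mono := by
    rintro (_ | _) (_ | _) (_ | _) <;> simp only [Refines, Apart] <;> (try tauto)
    rintro ⟨h1, h2⟩ (h | h)
    · exact Or.inl (lt_of_le_of_lt h2 h)
    · exact Or.inr (lt_of_lt_of_le h h1)

theorem Icc_le_Icc {a b c d : ℚ} (h : a < b) (h' : c < d) :
    Icc a b h ≤ Icc c d h' ↔ c ≤ a ∧ b ≤ d := Iff.rfl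

theorem le_whole (a : RatInterval) : a ≤ whole := by cases a <;> trivial

theorem not_whole_le {a b : ℚ} (h : a < b) : ¬ whole ≤ Icc a b h := id

theorem Icc_lt_Icc {a b c d : ℚ} (h : a < b) (h' : c < d) (h1 : c < a) (h2 : b < d) :
    Icc a b h < Icc c d h' := by
  rw [lt_iff_le_not_ge, Icc_le_Icc, Icc_le_Icc]
  exact ⟨⟨h1.le, h2.le⟩, fun h3 => absurd h1 (not_lt.2 h3.1)⟩

theorem isPoint_of_width {u : ℕ → RatInterval} (h1 : ∀ n, u (n + 1) ≤ u n)
    (h2 : ∀ n, ∃ m, u m < u n)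
    (h3 : ∀ ε : ℚ, 0 < ε → ∃ m p q h, u m = Icc p q h ∧ q - p < ε) : IsPoint u := by
  refine ⟨h1, h2, ?_⟩
  rintro (_ | ⟨a, b, hab⟩) (_ | ⟨c, d, hcd⟩) (h | h)
  · obtain ⟨m, p, q, hpq, hm, hw⟩ := h3 (a - d) (by linarith)
    refine ⟨m, ?_⟩
    rw [hm]
    change (b < p ∨ q < a) ∨ (d < p ∨ q < c)
    by_cases hq : q < a
    · exact Or.inl (Or.inr hq)
    · exact Or.inr (Or.inl (by linarith))
  · obtain ⟨m, p, q, hpq, hm, hw⟩ := h3 (c - b) (by linarith)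
    refine ⟨m, ?_⟩
    rw [hm]
    change (b < p ∨ q < a) ∨ (d < p ∨ q < c)
    by_cases hq : q < c
    · exact Or.inr (Or.inr hq)
    · exact Or.inl (Or.inl (by linarith))

theorem exists_pow_lt {r ε : ℚ} (hr : 0 < r) (hε : 0 < ε) : ∃ k : ℕ, r / 2 ^ k < ε := by
  obtain ⟨k, hk⟩ := exists_pow_lt_of_lt_one (div_pos hε hr) (by norm_num : (1 / 2 : ℚ) < 1)
  refine ⟨k, ?_⟩
  rw [lt_div_iff₀ hr, one_div, inv_pow] at hk
  rw [div_eq_mul_inv, mul_comm]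
  exact hk

theorem isPoint_center (c r : ℚ) (hr : 0 < r) :
    IsPoint (fun k : ℕ => Icc (c - r / 2 ^ k) (c + r / 2 ^ k)
      (by have : 0 < r / 2 ^ k := by positivity
          linarith)) := by
  have key : ∀ k : ℕ, r / 2 ^ (k + 1) < r / 2 ^ k := by
    intro k
    apply div_lt_div_of_pos_left hr (by positivity)
    exact pow_lt_pow_right₀ (by norm_num) (Nat.lt_succ_self k)
  have hs : ∀ k : ℕ, _ := fun k => Icc_lt_Icc (a := c - r / 2 ^ (k + 1))
    (b := c + r / 2 ^ (k + 1)) (c := c - r / 2 ^ k) (d := c + r / 2 ^ k)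
    (by have : 0 < r / 2 ^ (k + 1) := by positivity
        linarith)
    (by have : 0 < r / 2 ^ k := by positivity
        linarith) (by linarith [key k]) (by linarith [key k])
  refine isPoint_of_width (fun n => (hs n).le) (fun n => ⟨n + 1, hs n⟩) ?_
  intro ε hε
  obtain ⟨k, hk⟩ := exists_pow_lt hr (half_pos hε)
  exact ⟨k, _, _, _, rfl, by linarith⟩

instance : NaturalSpace RatInterval where
  top := whole
  le_top := le_whole
  exists_point := by
    rintro (_ | ⟨p, q, h⟩)
    · exact ⟨⟨_, isPoint_center 0 1 one_pos⟩, 0, lt_iff_le_not_ge.2 ⟨le_whole _, not_whole_le _⟩⟩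
    · refine ⟨⟨_, isPoint_center ((p + q) / 2) ((q - p) / 4) (by linarith)⟩, 0, ?_⟩
      exact Icc_lt_Icc _ _ (by simp only [pow_zero]; linarith) (by simp only [pow_zero]; linarith)

/-- The interval `[n / 2 ^ m, (n + 2) / 2 ^ m]`. -/
def dyadic (n : ℤ) (m : ℕ) : RatInterval :=
  Icc ((n : ℚ) / 2 ^ m) (((n : ℚ) + 2) / 2 ^ m) (by gcongr; linarith)

end RatInterval

/-- The set of natural real numbers. -/
abbrev NatReal : Type := Point RatInterval

/-! ### The spraid of narrow dyadic intervals -/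

/-- The dots of `σ_ℝ`: the whole line and the intervals `[n / 2 ^ m, (n + 2) / 2 ^ m]`, with
apartness and refinement restricted from the rational intervals. -/
def SigmaR : Type :=
  {a : RatInterval // a = RatInterval.whole ∨ ∃ (n : ℤ) (m : ℕ), a = RatInterval.dyadic n m}

namespace SigmaR

open RatInterval

theorem denumerable : Nonempty (ℕ ≃ SigmaR) := by
  have hc : Countable SigmaR := by
    obtain ⟨e⟩ := RatInterval.denumerable
    exact Function.Injective.countable (f := fun a : SigmaR => e.symm a.1)
      (e.symm.injective.comp Subtype.val_injective)
  have hi : Infinite SigmaR := by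
    refine Infinite.of_injective
      (fun n : ℕ => (⟨dyadic n 0, Or.inr ⟨n, 0, rfl⟩⟩ : SigmaR)) ?_
    intro m n h
    have h' : dyadic m 0 = dyadic n 0 := congrArg Subtype.val h
    simpa [dyadic] using h'
  exact (nonempty_denumerable SigmaR).elim fun d => ⟨(Denumerable.eqv SigmaR).symm⟩

instance : PreNaturalSpace SigmaR where
  __ := PartialOrder.lift (fun a : SigmaR => a.1) Subtype.val_injective
  countable := denumerable
  apart a b := PreNaturalSpace.apart a.1 b.1
  decidableApart a b := PreNaturalSpace.decidableApart a.1 b.1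
  decidableRefines a b := PreNaturalSpace.decidableRefines a.1 b.1
  apart_symm a b := PreNaturalSpace.apart_symm a.1 b.1
  apart_irrefl a := PreNaturalSpace.apart_irrefl a.1
  apart_mono a b c := PreNaturalSpace.apart_mono a.1 b.1 c.1

theorem isPoint_of_val {u : ℕ → SigmaR} (h : IsPoint (fun n => (u n).1)) : IsPoint u :=
  ⟨h.shrinking, h.strict, fun a b hab => h.decides a.1 b.1 hab⟩

theorem dyadic_level_lt {n n' : ℤ} {m m' : ℕ} (h : dyadic n' m' < dyadic n m) : m < m' := by
  by_contra hm
  obtain ⟨⟨h1, h2⟩, h3⟩ := lt_iff_le_not_ge.1 h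
  have hw : (1 : ℚ) / 2 ^ m ≤ 1 / 2 ^ m' := by
    apply one_div_le_one_div_of_le (by positivity)
    exact pow_le_pow_right₀ (by norm_num) (not_lt.1 hm)
  rw [add_div, add_div] at h2
  have e1 : (2 : ℚ) / 2 ^ m = 2 * (1 / 2 ^ m) := by ring
  have e2 : (2 : ℚ) / 2 ^ m' = 2 * (1 / 2 ^ m') := by ring
  apply h3
  refine ⟨by linarith, ?_⟩
  rw [add_div, add_div]
  linarith

/-- A point of `σ_ℝ` is a point of the natural reals. -/
theorem isPoint_val {u : ℕ → SigmaR} (h : IsPoint u) : IsPoint (fun n => (u n).1) := by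
  have step : ∀ m, ∃ k, (u k).1 < (u m).1 := h.strict
  have level : ∀ N : ℕ, ∃ k n m, (u k).1 = dyadic n m ∧ N ≤ m := by
    intro N
    induction N with
    | zero =>
      obtain ⟨k, hk⟩ := step 0
      rcases (u k).2 with hw | ⟨n, m, hd⟩
      · rw [hw] at hk
        exact absurd hk (not_lt_of_ge (le_whole _))
      · exact ⟨k, n, m, hd, Nat.zero_le _⟩
    | succ N ih =>
      obtain ⟨j, n, m, hj, hN⟩ := ih
      obtain ⟨k, hk⟩ := step j
      rcases (u k).2 with hw | ⟨n', m', hd⟩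
      · rw [hw] at hk
        exact absurd hk (not_lt_of_ge (le_whole _))
      · rw [hd, hj] at hk
        have := dyadic_level_lt hk
        exact ⟨k, n', m', hd, by omega⟩
  refine isPoint_of_width h.shrinking step ?_
  intro ε hε
  obtain ⟨N, hN⟩ := exists_pow_lt (by norm_num : (0 : ℚ) < 2) hε
  obtain ⟨k, n, m, hk, hm⟩ := level N
  refine ⟨k, _, _, _, hk, ?_⟩
  have : (2 : ℚ) / 2 ^ m ≤ 2 / 2 ^ N := by
    apply div_le_div_of_nonneg_left (by norm_num) (by positivity)
    exact pow_le_pow_right₀ (by norm_num) hm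
  rw [add_div]
  linarith

theorem exists_point_dyadic (n : ℤ) (m : ℕ) :
    ∃ p : Point SigmaR, ∃ k, (p.1 k).1 < dyadic n m := by
  let c : ℚ := ((n : ℚ) + 1) / 2 ^ m
  have hp := isPoint_center c (1 / 2 ^ (m + 1)) (by positivity)
  have hmem : ∀ k : ℕ, ∃ (n' : ℤ) (m' : ℕ),
      Icc (c - 1 / 2 ^ (m + 1) / 2 ^ k) (c + 1 / 2 ^ (m + 1) / 2 ^ k)
        (by have : (0 : ℚ) < 1 / 2 ^ (m + 1) / 2 ^ k := by positivity
            linarith) = dyadic n' m' := by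
    intro k
    refine ⟨(n + 1) * 2 ^ (k + 1) - 1, m + 1 + k, ?_⟩
    have h2 : (2 : ℚ) ^ m ≠ 0 := by positivity
    have h3 : (2 : ℚ) ^ k ≠ 0 := by positivity
    unfold dyadic
    congr 1
    · simp only [c]; push_cast; rw [pow_add, pow_succ, pow_succ]; field_simp; ring
    · simp only [c]; push_cast; rw [pow_add, pow_succ, pow_succ]; field_simp; ring
  refine ⟨⟨fun k => ⟨_, Or.inr (hmem k)⟩, isPoint_of_val hp⟩, 0, ?_⟩
  have h1 : (1 : ℚ) / 2 ^ (m + 1) < 1 / 2 ^ m := by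
    apply one_div_lt_one_div_of_lt (by positivity)
    exact pow_lt_pow_right₀ (by norm_num) (Nat.lt_succ_self m)
  refine Icc_lt_Icc _ _ ?_ ?_
  · simp only [c, pow_zero, div_one, add_div]; linarith
  · have e1 : (2 : ℚ) / 2 ^ m = 2 * (1 / 2 ^ m) := by ring
    simp only [c, pow_zero, div_one, add_div]; linarith

instance : NaturalSpace SigmaR where
  top := ⟨whole, Or.inl rfl⟩
  le_top a := le_whole a.1
  exists_point := by
    rintro ⟨a, rfl | ⟨n, m, rfl⟩⟩
    · obtain ⟨p, k, hk⟩ := exists_point_dyadic 0 0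
      exact ⟨p, k, lt_of_lt_of_le (a := (p.1 k).1) hk (le_whole _)⟩
    · exact exists_point_dyadic n m

/-- The inclusion of the points of `σ_ℝ` into the natural reals. -/
def toNatReal (p : Point SigmaR) : NatReal := ⟨fun n => (p.1 n).1, isPoint_val p.2⟩

end SigmaR

end NTop

/-! A natural real determines a real number, the one common to all its dots (`NatReal.val`), and two
natural reals are apart exactly when these numbers differ (`NatReal.apart_iff_val_ne`). So `f` may
be replaced by the continuous real function `F = val ∘ f`, and it remains to assign to each dot `a`
a dot of `σ_ℝ` containing `F(hat a)`, monotonically in `a` and with widths tending to 0 along each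
point.

For each `a` take the finest scale `8 ^ -k`, with `k` at most the number of predecessors of `a`, at
which `F(hat a)` lies in some `[n, n + 2] / 8 ^ k` with margin `1/4` on both sides (`level`,
`index`). The margin absorbs a change of level: every interval chosen at a deeper level lies inside
every one chosen at a coarser level (`FitsAt.bounds`). Within one level the choices for `a` and for
its predecessors can disagree, so they are intersected. Indices that fit the same dot differ by at
most one, hence the intersection is again a dot of `σ_ℝ` (`exists_intersection`), and the resulting
map `approx` is monotone (`approx_mono`).

Continuity and the growing number of predecessors make the levels unbounded along a point, so
`approx` sends points to points (`isPoint_approx`). It preserves the value of `F`, which gives both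
the equivalence with `f` and the reflection of apartness, since a continuous real function separates
only points that are apart (`Point.apart_of_ne`). -/

namespace NTop

universe u

/-! ### Dots as subsets of the real line. -/

namespace RatInterval

/-- The set of real numbers that lie in a dot of the natural reals. -/
def carrier : RatInterval → Set ℝ
  | whole => Set.univ
  | Icc p q _ => Set.Icc (p : ℝ) (q : ℝ)

theorem Icc_congr {a b c d : ℚ} (h : a < b) (h' : c < d) (h1 : a = c) (h2 : b = d) :
    Icc a b h = Icc c d h' := by
  subst h1 h2
  rfl

theorem carrier_mono {a b : RatInterval} (h : a ≤ b) : carrier a ⊆ carrier b := by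
  rcases b with _ | ⟨c, d, hcd⟩
  · exact Set.subset_univ _
  rcases a with _ | ⟨p, q, hpq⟩
  · exact absurd h (not_whole_le hcd)
  · obtain ⟨h1, h2⟩ := (Icc_le_Icc hpq hcd).1 h
    exact Set.Icc_subset_Icc (by exact_mod_cast h1) (by exact_mod_cast h2)

theorem not_apart_of_mem {a b : RatInterval} {x : ℝ} (ha : x ∈ carrier a) (hb : x ∈ carrier b) :
    ¬ PreNaturalSpace.apart a b := by
  rcases a with _ | ⟨p, q, hpq⟩
  · exact id
  rcases b with _ | ⟨c, d, hcd⟩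
  · exact id
  rintro (h | h)
  · have h' : (d : ℝ) < p := by exact_mod_cast h
    linarith [ha.1, hb.2]
  · have h' : (q : ℝ) < c := by exact_mod_cast h
    linarith [ha.2, hb.1]

theorem apart_of_subset {a b : RatInterval} {x : ℝ} (ha : carrier a ⊆ Set.Iio x)
    (hb : carrier b ⊆ Set.Ioi x) : PreNaturalSpace.apart a b := by
  rcases a with _ | ⟨p, q, hpq⟩
  · exact absurd (ha (Set.mem_univ x)) (lt_irrefl x)
  rcases b with _ | ⟨c, d, hcd⟩
  · exact absurd (hb (Set.mem_univ x)) (lt_irrefl x)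
  have h1 : (q : ℝ) < x := ha ⟨by exact_mod_cast hpq.le, le_rfl⟩
  have h2 : x < (c : ℝ) := hb ⟨le_rfl, by exact_mod_cast hcd.le⟩
  exact Or.inr (by exact_mod_cast h1.trans h2)

theorem subset_Iio_of_apart {a : RatInterval} {x : ℝ} {c d : ℚ} (h : c < d) (hx : x ∈ carrier a)
    (hc : x < c) (ha : PreNaturalSpace.apart a (Icc c d h)) : carrier a ⊆ Set.Iio (c : ℝ) := by
  rcases a with _ | ⟨p, q, hpq⟩
  · exact ha.elim
  have h' : (c : ℝ) < d := by exact_mod_cast h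
  rcases ha with ha | ha
  · have : (d : ℝ) < p := by exact_mod_cast ha
    linarith [hx.1]
  · have : (q : ℝ) < c := by exact_mod_cast ha
    exact fun y hy => lt_of_le_of_lt hy.2 this

theorem subset_Ioi_of_apart {a : RatInterval} {x : ℝ} {c d : ℚ} (h : c < d) (hx : x ∈ carrier a)
    (hd : (d : ℝ) < x) (ha : PreNaturalSpace.apart a (Icc c d h)) :
    carrier a ⊆ Set.Ioi (d : ℝ) := by
  rcases a with _ | ⟨p, q, hpq⟩
  · exact ha.elim
  have h' : (c : ℝ) < d := by exact_mod_cast h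
  rcases ha with ha | ha
  · have : (d : ℝ) < p := by exact_mod_cast ha
    exact fun y hy => lt_of_lt_of_le this hy.1
  · have : (q : ℝ) < c := by exact_mod_cast ha
    linarith [hx.2]

end RatInterval

/-! ### Continuous real functions on a space of points. -/

namespace Point

theorem mem_hat {V : Type u} [PreNaturalSpace V] (p : Point V) (n : ℕ) : p ∈ hat (p.1 n) :=
  p.2.strict n

theorem hat_nonempty {V : Type u} [NaturalSpace V] (a : V) : (hat a).Nonempty :=
  NaturalSpace.exists_point a

/-- A continuous real-valued function is nearly constant on a small enough dot of a point. -/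
theorem exists_hat_subset_preimage {V : Type u} [PreNaturalSpace V] {F : Point V → ℝ}
    (hF : Continuous F) (p : Point V) {s : Set ℝ} (hs : IsOpen s) (hp : F p ∈ s) :
    ∃ m, hat (p.1 m) ⊆ F ⁻¹' s := by
  have hopen : IsOpen (F ⁻¹' s) := hs.preimage hF
  rcases hopen p hp p with ⟨n, hn⟩ | h
  · exact absurd hn (PreNaturalSpace.apart_irrefl _)
  · exact h

/-- A continuous real-valued function separates only points that lie apart. -/
theorem apart_of_ne {V : Type u} [PreNaturalSpace V] {F : Point V → ℝ} (hF : Continuous F)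
    {p q : Point V} (h : F p ≠ F q) : Apart p q := by
  have hopen : IsOpen (F ⁻¹' {F p}ᶜ) := isOpen_compl_singleton.preimage hF
  -- The other alternative puts `p` itself, which belongs to each of its own dots, into the
  -- complement of the fibre of `F p`.
  rcases hopen q (fun h' => h h'.symm) p with h' | ⟨m, hm⟩
  · exact h'
  · exact absurd rfl (hm (p.mem_hat m))

end Point

/-! ### The real number determined by a natural real. -/

namespace NatReal

open RatInterval

/-- Nested compact intervals meet. The first dot may be the whole line, so the sequence is started
after a strict refinement, where it is bounded. -/
theorem exists_mem_carrier (z : NatReal) : ∃ x : ℝ, ∀ n, x ∈ carrier (z.1 n) := by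
  obtain ⟨N, hN⟩ := z.2.strict 0
  have hIcc : IsCompact (carrier (z.1 (0 + N))) := by
    rw [zero_add]
    rcases hz : z.1 N with _ | ⟨p, q, hpq⟩
    · rw [hz] at hN
      exact absurd hN (not_lt_of_ge (le_whole _))
    · exact isCompact_Icc
  obtain ⟨x, hx⟩ := IsCompact.nonempty_iInter_of_sequence_nonempty_isCompact_isClosed
    (fun n => carrier (z.1 (n + N)))
    (fun n => carrier_mono (z.le_of_le (by omega)))
    (fun n => by
      rcases z.1 (n + N) with _ | ⟨p, q, hpq⟩
      · exact Set.univ_nonempty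
      · exact Set.nonempty_Icc.2 (by exact_mod_cast hpq.le))
    hIcc
    (fun n => by
      rcases z.1 (n + N) with _ | ⟨p, q, hpq⟩
      · exact isClosed_univ
      · exact isClosed_Icc)
  exact ⟨x, fun n => carrier_mono (z.le_of_le (Nat.le_add_right n N)) (Set.mem_iInter.1 hx n)⟩

/-- The real number in all the dots of a natural real. -/
noncomputable def val (z : NatReal) : ℝ := (exists_mem_carrier z).choose

theorem val_mem (z : NatReal) (n : ℕ) : val z ∈ carrier (z.1 n) :=
  (exists_mem_carrier z).choose_spec n

/-- The point must decide between two disjoint rational intervals, one around `val z` and one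
between it and `y`. Its dots contain `val z`, so it can only move away from the second. -/
theorem exists_subset_Iio (z : NatReal) {y : ℝ} (h : val z < y) :
    ∃ m, carrier (z.1 m) ⊆ Set.Iio y := by
  obtain ⟨b, hb1, hb2⟩ := exists_rat_btwn h
  obtain ⟨a, ha1, ha2⟩ := exists_rat_btwn hb1
  obtain ⟨c, hc⟩ := exists_rat_lt (val z)
  have hab : a < b := by exact_mod_cast ha2
  have hca : c < a := by exact_mod_cast hc.trans ha1
  obtain ⟨m, hm | hm⟩ := z.2.decides (Icc c a hca) (Icc b (b + 1) (lt_add_one b)) (Or.inr hab)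
  · exact absurd hm (not_apart_of_mem (val_mem z m) ⟨hc.le, ha1.le⟩)
  · exact ⟨m, (subset_Iio_of_apart _ (val_mem z m) hb1 hm).trans (Set.Iio_subset_Iio hb2.le)⟩

theorem exists_subset_Ioi (z : NatReal) {y : ℝ} (h : y < val z) :
    ∃ m, carrier (z.1 m) ⊆ Set.Ioi y := by
  obtain ⟨b, hb1, hb2⟩ := exists_rat_btwn h
  obtain ⟨a, ha1, ha2⟩ := exists_rat_btwn hb2
  obtain ⟨c, hc⟩ := exists_rat_gt (val z)
  have hab : b < a := by exact_mod_cast ha1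
  have hac : a < c := by exact_mod_cast ha2.trans hc
  obtain ⟨m, hm | hm⟩ := z.2.decides (Icc a c hac) (Icc (b - 1) b (sub_one_lt b)) (Or.inl hab)
  · exact absurd hm (not_apart_of_mem (val_mem z m) ⟨ha2.le, hc.le⟩)
  · exact ⟨m, (subset_Ioi_of_apart _ (val_mem z m) hb2 hm).trans (Set.Ioi_subset_Ioi hb1.le)⟩

theorem apart_of_val_lt {y z : NatReal} (h : val y < val z) : Point.Apart y z := by
  obtain ⟨x, hx1, hx2⟩ := exists_between h
  obtain ⟨m, hm⟩ := exists_subset_Iio y hx1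
  obtain ⟨k, hk⟩ := exists_subset_Ioi z hx2
  exact ⟨max m k, apart_of_subset
    ((carrier_mono (y.le_of_le (le_max_left m k))).trans hm)
    ((carrier_mono (z.le_of_le (le_max_right m k))).trans hk)⟩

theorem apart_iff_val_ne {y z : NatReal} : Point.Apart y z ↔ val y ≠ val z := by
  constructor
  · rintro ⟨n, hn⟩ h
    exact not_apart_of_mem (val_mem y n) (h ▸ val_mem z n) hn
  · intro h
    rcases h.lt_or_gt with h | h
    · exact apart_of_val_lt h
    · obtain ⟨n, hn⟩ := apart_of_val_lt h
      exact ⟨n, (PreNaturalSpace.apart_symm _ _).1 hn⟩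

theorem continuous_val : Continuous val := by
  refine continuous_def.2 fun s hs z hz y => ?_
  by_cases h : Point.Apart y z
  · exact Or.inl h
  have hyz : val y = val z := not_not.1 (mt apart_iff_val_ne.2 h)
  have hy : val y ∈ s := hyz ▸ hz
  obtain ⟨l, r, hlr, hsub⟩ := mem_nhds_iff_exists_Ioo_subset.1 (hs.mem_nhds hy)
  obtain ⟨m, hm⟩ := exists_subset_Iio y hlr.2
  obtain ⟨k, hk⟩ := exists_subset_Ioi y hlr.1
  refine Or.inr ⟨max m k, ?_⟩
  rintro w ⟨j, hj⟩
  have hw := carrier_mono hj.le (val_mem w j)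
  exact hsub ⟨hk (carrier_mono (y.le_of_le (le_max_right m k)) hw),
    hm (carrier_mono (y.le_of_le (le_max_left m k)) hw)⟩

theorem val_eq_of_mem {z : NatReal} {x : ℝ} (h : ∀ n, x ∈ carrier (z.1 n)) : val z = x := by
  rcases lt_trichotomy (val z) x with hlt | heq | hlt
  · obtain ⟨m, hm⟩ := exists_subset_Iio z hlt
    exact absurd (hm (h m)) (lt_irrefl x)
  · exact heq
  · obtain ⟨m, hm⟩ := exists_subset_Ioi z hlt
    exact absurd (hm (h m)) (lt_irrefl x)

end NatReal

/-! ### Dyadic approximation of a real-valued function on the points -/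

section Approximation

open RatInterval Point

variable {V : Type u} [NaturalSpace V] (F : Point V → ℝ)

/-- The values of `F` on the dot `a` lie well inside `[n / 8 ^ k, (n + 2) / 8 ^ k]`. -/
def FitsAt (a : V) (k : ℕ) (n : ℤ) : Prop :=
  ∀ p ∈ hat a, (n : ℝ) + 1 / 4 ≤ 8 ^ k * F p ∧ 8 ^ k * F p ≤ n + 7 / 4

theorem FitsAt.mono {F : Point V → ℝ} {a b : V} (h : a ≤ b) {k : ℕ} {n : ℤ}
    (hb : FitsAt F b k n) : FitsAt F a k n :=
  fun p hp => hb p (hat_mono h hp)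

theorem FitsAt.le_add_one {F : Point V → ℝ} {a : V} {k : ℕ} {m n : ℤ}
    (hm : FitsAt F a k m) (hn : FitsAt F a k n) : m ≤ n + 1 := by
  obtain ⟨p, hp⟩ := hat_nonempty a
  have h : (m : ℝ) < (n : ℝ) + 2 := by linarith [(hm p hp).1, (hn p hp).2]
  have h' : m < n + 2 := by exact_mod_cast h
  omega

/-- At a deeper level an interval that fits lies inside any interval that fits. -/
theorem FitsAt.bounds {F : Point V → ℝ} {a : V} {k l : ℕ} (hkl : k < l) {m n : ℤ}
    (hm : FitsAt F a k m) (hn : FitsAt F a l n) :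
    m * 8 ^ (l - k) ≤ n ∧ n + 2 ≤ (m + 2) * 8 ^ (l - k) := by
  obtain ⟨p, hp⟩ := hat_nonempty a
  obtain ⟨d, rfl⟩ := Nat.exists_eq_add_of_lt hkl
  have e : k + d + 1 - k = d + 1 := by omega
  rw [e]
  obtain ⟨h1, h2⟩ := hm p hp
  obtain ⟨h3, h4⟩ := hn p hp
  -- This is where base 8 and margin `1/4` matter: rescaled to the deeper level the margin is at
  -- least `8 * (1/4) = 2`, more than the `7/4` by which an endpoint of the deeper interval can lie
  -- from a value of `F`.
  have h8 : (8 : ℝ) ≤ 8 ^ (d + 1) := by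
    simpa using pow_le_pow_right₀ (by norm_num : (1 : ℝ) ≤ 8) (Nat.le_add_left 1 d)
  have e2 : (8 : ℝ) ^ (k + d + 1) * F p = 8 ^ (d + 1) * (8 ^ k * F p) := by
    rw [add_assoc, pow_add]; ring
  rw [e2] at h3 h4
  have h5 := mul_le_mul_of_nonneg_left h1 (by linarith : (0 : ℝ) ≤ 8 ^ (d + 1))
  have h6 := mul_le_mul_of_nonneg_left h2 (by linarith : (0 : ℝ) ≤ 8 ^ (d + 1))
  constructor
  · have : ((m * 8 ^ (d + 1) : ℤ) : ℝ) ≤ (n : ℤ) := by push_cast; linarith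
    exact_mod_cast this
  · have : ((n + 2 : ℤ) : ℝ) ≤ (((m + 2) * 8 ^ (d + 1) : ℤ) : ℝ) := by push_cast; linarith
    exact_mod_cast this

/-! ### The level of a dot and the interval chosen for it. -/

open Classical in
/-- The finest level, at most the number of predecessors of `a`, at which some interval fits. -/
noncomputable def level (a : V) : ℕ :=
  -- The bound is needed because a dot on which `F` is constant fits at every level. The number of
  -- predecessors grows under refinement and is unbounded along a point. The value 0 also serves as
  -- default when nothing fits, so level 0 carries no information.
  Nat.findGreatest (fun k => ∃ n, FitsAt F a k n) (Set.ncard {b : V | a ≤ b})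

theorem exists_fitsAt_level {a : V} (h : level F a ≠ 0) : ∃ n, FitsAt F a (level F a) n := by
  classical
  exact Nat.findGreatest_of_ne_zero (m := level F a) rfl h

/-- The index of an interval that fits at the level of `a`. -/
noncomputable def index (a : V) : ℤ := Classical.epsilon (FitsAt F a (level F a))

theorem fitsAt_index {a : V} (h : level F a ≠ 0) : FitsAt F a (level F a) (index F a) :=
  Classical.epsilon_spec (exists_fitsAt_level F h)

theorem level_anti (hV : ∀ a : V, {b : V | a ≤ b}.Finite) {a b : V} (h : a ≤ b) :
    level F b ≤ level F a := by
  classical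
  exact Nat.findGreatest_mono (fun k ⟨n, hn⟩ => ⟨n, hn.mono h⟩)
    (Set.ncard_le_ncard (fun c hc => h.trans hc) (hV a))

/-! ### Intersecting the choices made at one level. -/

/-- The indices of the intervals chosen for the predecessors of `a` of the same level. -/
def indices (a : V) : Set ℤ := index F '' {b | a ≤ b ∧ level F b = level F a}

theorem index_mem_indices (a : V) : index F a ∈ indices F a := ⟨a, ⟨le_rfl, rfl⟩, rfl⟩

variable {F} in
theorem fitsAt_of_mem_indices {a : V} (h : level F a ≠ 0) {n : ℤ} (hn : n ∈ indices F a) :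
    FitsAt F a (level F a) n := by
  obtain ⟨b, ⟨hab, hb⟩, rfl⟩ := hn
  have := fitsAt_index F (a := b) (hb ▸ h)
  rw [hb] at this
  exact this.mono hab

/-- The source of monotonicity within a level: `index` alone need not respect refinement, but a
finer dot intersects over more predecessors. -/
theorem indices_subset {a b : V} (h : a ≤ b) (hl : level F a = level F b) :
    indices F b ⊆ indices F a := by
  rintro _ ⟨c, ⟨hbc, hc⟩, rfl⟩
  exact ⟨c, ⟨h.trans hbc, hc.trans hl.symm⟩, rfl⟩

/-- All these indices fit `a`, so any two differ by at most one and they form `{n}` or `{n, n + 1}`.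
The intersection has length 2 or 1 in units of `8 ^ -k = 2 ^ -(3 * k)`, where `k` is the level;
length 1 is a dot of `σ_ℝ` one binary level further down. Here `l` is the largest index and `r - 2`
the smallest. -/
theorem exists_intersection (a : V) (h : level F a ≠ 0) : ∃ d : SigmaR, ∃ l r : ℤ, ∃ hlr,
    d.1 = Icc ((l : ℚ) / 8 ^ level F a) ((r : ℚ) / 8 ^ level F a) hlr ∧
    l ∈ indices F a ∧ r - 2 ∈ indices F a ∧ ∀ n ∈ indices F a, n ≤ l ∧ r ≤ n + 2 := by
  have e8 : (8 : ℚ) ^ level F a = 2 ^ (3 * level F a) := by rw [pow_mul]; norm_num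
  by_cases hc : ∃ n ∈ indices F a, n + 1 ∈ indices F a
  · obtain ⟨n, hn, hn1⟩ := hc
    refine ⟨⟨dyadic (2 * (n + 1)) (3 * level F a + 1), Or.inr ⟨_, _, rfl⟩⟩, n + 1, n + 2,
      ?_, ?_, hn1, by simpa using hn, fun j hj => ?_⟩
    · gcongr; linarith
    · refine Icc_congr _ _ ?_ ?_
      · rw [e8, pow_succ]; push_cast; field_simp
      · rw [e8, pow_succ]; push_cast; field_simp; ring
    · have h1 := (fitsAt_of_mem_indices h hj).le_add_one (fitsAt_of_mem_indices h hn)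
      have h2 := (fitsAt_of_mem_indices h hn1).le_add_one (fitsAt_of_mem_indices h hj)
      omega
  · have hi := index_mem_indices F a
    refine ⟨⟨dyadic (index F a) (3 * level F a), Or.inr ⟨_, _, rfl⟩⟩, index F a, index F a + 2,
      ?_, ?_, hi, by simpa using hi, fun j hj => ?_⟩
    · gcongr; linarith
    · refine Icc_congr _ _ ?_ ?_
      · rw [e8]
      · rw [e8]; push_cast; ring
    · have h1 := (fitsAt_of_mem_indices h hj).le_add_one (fitsAt_of_mem_indices h hi)
      have h2 := (fitsAt_of_mem_indices h hi).le_add_one (fitsAt_of_mem_indices h hj)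
      have h3 : j ≠ index F a + 1 := fun e => hc ⟨_, hi, e ▸ hj⟩
      have h4 : index F a ≠ j + 1 := fun e => hc ⟨_, hj, e ▸ hi⟩
      omega

open Classical in
/-- The intersection of the intervals chosen for the predecessors of `a` of the same level; the
whole line at level `0`. -/
noncomputable def approx (a : V) : SigmaR :=
  if h : level F a = 0 then ⊤ else (exists_intersection F a h).choose

theorem approx_of_level_eq_zero {a : V} (h : level F a = 0) : approx F a = ⊤ := dif_pos h

theorem approx_spec {a : V} (h : level F a ≠ 0) : ∃ l r : ℤ, ∃ hlr,
    (approx F a).1 = Icc ((l : ℚ) / 8 ^ level F a) ((r : ℚ) / 8 ^ level F a) hlr ∧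
    l ∈ indices F a ∧ r - 2 ∈ indices F a ∧ ∀ n ∈ indices F a, n ≤ l ∧ r ≤ n + 2 := by
  rw [approx, dif_neg h]
  exact (exists_intersection F a h).choose_spec

theorem approx_mono (hV : ∀ a : V, {b : V | a ≤ b}.Finite) {a b : V} (h : a ≤ b) :
    approx F a ≤ approx F b := by
  by_cases hb : level F b = 0
  · rw [approx_of_level_eq_zero F hb]
    exact le_top
  have hl := level_anti F hV h
  have ha : level F a ≠ 0 := by omega
  obtain ⟨l, r, hlr, e, hl1, hr1, h1⟩ := approx_spec F ha
  obtain ⟨l', r', hlr', e', hl1', hr1', h1'⟩ := approx_spec F hb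
  change (approx F a).1 ≤ (approx F b).1
  rw [e, e', Icc_le_Icc]
  rcases hl.eq_or_lt with heq | hlt
  · have hs := indices_subset F h heq.symm
    have h2 : (l' : ℚ) ≤ l := by exact_mod_cast (h1 l' (hs hl1')).1
    have h3 : (r : ℚ) ≤ r' := by
      have := (h1 _ (hs hr1')).2
      exact_mod_cast (by omega : r ≤ r')
    rw [heq]
    exact ⟨by gcongr, by gcongr⟩
  -- Deeper level: both endpoints for `b` come from intervals that fit `b`, hence `a`, and these
  -- contain the whole interval of `index F a`, so also the intersection for `a`.
  · have hfit := fitsAt_of_mem_indices ha (index_mem_indices F a)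
    have h2 := (((fitsAt_of_mem_indices hb hl1').mono h).bounds hlt hfit).1
    have h3 := (((fitsAt_of_mem_indices hb hr1').mono h).bounds hlt hfit).2
    obtain ⟨h4, h5⟩ := h1 _ (index_mem_indices F a)
    have e8 : (8 : ℚ) ^ level F a = 8 ^ (level F a - level F b) * 8 ^ level F b := by
      rw [← pow_add]; congr 1; omega
    have h6 : (l' : ℚ) * 8 ^ (level F a - level F b) ≤ l := by exact_mod_cast h2.trans h4
    have h7 : (r : ℚ) ≤ r' * 8 ^ (level F a - level F b) := by
      rw [sub_add_cancel] at h3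
      exact_mod_cast h5.trans h3
    rw [e8, div_le_div_iff₀ (by positivity) (by positivity),
      div_le_div_iff₀ (by positivity) (by positivity)]
    refine ⟨?_, ?_⟩
    · rw [← mul_assoc]; gcongr
    · rw [← mul_assoc]; gcongr

theorem mem_carrier_approx {a : V} {p : Point V} (hp : p ∈ hat a) :
    F p ∈ carrier (approx F a).1 := by
  by_cases ha : level F a = 0
  · rw [approx_of_level_eq_zero F ha]
    exact Set.mem_univ _
  obtain ⟨l, r, hlr, e, hl, hr, -⟩ := approx_spec F ha
  have h1 := (fitsAt_of_mem_indices ha hl p hp).1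
  have h2 := (fitsAt_of_mem_indices ha hr p hp).2
  rw [e]
  constructor
  · push_cast
    rw [div_le_iff₀ (by positivity)]
    linarith
  · push_cast at h2 ⊢
    rw [le_div_iff₀ (by positivity)]
    linarith

theorem approx_width {a : V} (h : level F a ≠ 0) : ∃ p q hpq,
    (approx F a).1 = Icc p q hpq ∧ 1 / 8 ^ level F a ≤ q - p ∧ q - p ≤ 2 / 8 ^ level F a := by
  obtain ⟨l, r, hlr, e, hl, hr, h1⟩ := approx_spec F h
  refine ⟨_, _, hlr, e, ?_, ?_⟩
  · rw [← sub_div]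
    have : l < r := by exact_mod_cast (div_lt_div_iff_of_pos_right (by positivity)).1 hlr
    have : ((1 : ℤ) : ℚ) ≤ ((r - l : ℤ) : ℚ) := by exact_mod_cast (by omega : 1 ≤ r - l)
    push_cast at this
    gcongr
  · rw [← sub_div]
    have : ((r - l : ℤ) : ℚ) ≤ ((2 : ℤ) : ℚ) := by
      have := (h1 l hl).2
      exact_mod_cast (by omega : r - l ≤ 2)
    push_cast at this
    gcongr

/-! ### Convergence along points. -/

variable {F}

theorem exists_fitsAt (hF : Continuous F) (p : Point V) (k : ℕ) :
    ∃ m n, FitsAt F (p.1 m) k n := by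
  set x := 8 ^ k * F p with hx
  -- The shift by `1/2` puts `x` in `[n + 1/2, n + 3/2)`, strictly inside the window from `n + 1/4`
  -- to `n + 7/4`, so continuity applies.
  have hn1 := Int.floor_le (x - 1 / 2)
  have hn2 := Int.lt_floor_add_one (x - 1 / 2)
  set n := ⌊x - 1 / 2⌋
  have hopen : IsOpen ((fun y : ℝ => 8 ^ k * y) ⁻¹' Set.Ioo ((n : ℝ) + 1 / 4) (n + 7 / 4)) :=
    isOpen_Ioo.preimage (by fun_prop)
  obtain ⟨m, hm⟩ := exists_hat_subset_preimage hF p hopen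
    ⟨by change _ < x; linarith, by change x < _; linarith⟩
  exact ⟨m, n, fun q hq => ⟨(hm hq).1.le, (hm hq).2.le⟩⟩

theorem exists_le_ncard (hV : ∀ a : V, {b : V | a ≤ b}.Finite) (p : Point V) (k : ℕ) :
    ∃ m, k ≤ Set.ncard {b : V | p.1 m ≤ b} := by
  induction k with
  | zero => exact ⟨0, Nat.zero_le _⟩
  | succ k ih =>
    obtain ⟨m, hm⟩ := ih
    obtain ⟨j, hj⟩ := p.2.strict m
    refine ⟨j, hm.trans_lt (Set.ncard_lt_ncard ⟨fun c hc => hj.le.trans hc, fun h => ?_⟩ (hV _))⟩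
    exact hj.not_ge (h (le_refl (p.1 j)))

theorem exists_le_level (hV : ∀ a : V, {b : V | a ≤ b}.Finite) (hF : Continuous F)
    (p : Point V) (k : ℕ) : ∃ m, k ≤ level F (p.1 m) := by
  classical
  obtain ⟨i, n, hi⟩ := exists_fitsAt hF p k
  obtain ⟨j, hj⟩ := exists_le_ncard hV p k
  refine ⟨max i j, Nat.le_findGreatest (hj.trans ?_) ⟨n, ?_⟩⟩
  · exact Set.ncard_le_ncard (fun c hc => (p.le_of_le (le_max_right i j)).trans hc) (hV _)
  · exact hi.mono (p.le_of_le (le_max_left i j))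

theorem exists_approx_width_lt (hV : ∀ a : V, {b : V | a ≤ b}.Finite) (hF : Continuous F)
    (p : Point V) {ε : ℚ} (hε : 0 < ε) :
    ∃ m x y h, (approx F (p.1 m)).1 = Icc x y h ∧ y - x < ε := by
  obtain ⟨k, hk⟩ := exists_pow_lt (by norm_num : (0 : ℚ) < 2) hε
  -- `k + 1` rather than `k` makes the level nonzero, so that the dot is not the whole line.
  obtain ⟨m, hm⟩ := exists_le_level hV hF p (k + 1)
  obtain ⟨x, y, h, e, -, hw⟩ := approx_width F (a := p.1 m) (by omega)
  refine ⟨m, x, y, h, e, (hw.trans ?_).trans_lt hk⟩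
  apply div_le_div_of_nonneg_left (by norm_num) (by positivity)
  calc (2 : ℚ) ^ k ≤ 8 ^ k := by gcongr; norm_num
    _ ≤ 8 ^ level F (p.1 m) := pow_le_pow_right₀ (by norm_num) (by omega)

/-- A strict refinement in `V` may leave `approx` unchanged; strictness is recovered later along the
point, from widths tending to 0. -/
theorem isPoint_approx (hV : ∀ a : V, {b : V | a ≤ b}.Finite) (hF : Continuous F)
    (p : Point V) : IsPoint (fun n => approx F (p.1 n)) := by
  refine SigmaR.isPoint_of_val (isPoint_of_width (fun n => approx_mono F hV (p.2.shrinking n))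
    (fun n => ?_) fun ε hε => exists_approx_width_lt hV hF p hε)
  have key : ∀ m, ¬ (approx F (p.1 n)).1 ≤ (approx F (p.1 m)).1 →
      ∃ m, (approx F (p.1 m)).1 < (approx F (p.1 n)).1 := by
    intro m hm
    rcases le_total n m with h | h
    · exact ⟨m, lt_of_le_not_ge (approx_mono F hV (p.le_of_le h)) hm⟩
    · exact absurd (approx_mono F hV (p.le_of_le h)) hm
  obtain ⟨c, hn⟩ : ∃ c, (approx F (p.1 n)).1 = c := ⟨_, rfl⟩
  rcases c with _ | ⟨a, b, hab⟩
  · obtain ⟨m, x, y, h, e, -⟩ := exists_approx_width_lt hV hF p one_pos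
    exact key m (by rw [hn, e]; exact not_whole_le h)
  · obtain ⟨m, x, y, h, e, hw⟩ := exists_approx_width_lt hV hF p (sub_pos.2 hab)
    refine key m ?_
    rw [hn, e, Icc_le_Icc]
    rintro ⟨h1, h2⟩
    linarith

end Approximation

end NTop

/-! ### The refinement morphism. -/

theorem mainTheorem1 {V : Type*} [NTop.NaturalSpace V] (hV : NTop.IsSpraid V)
    (f : NTop.Point V → NTop.NatReal) (hf : Continuous f) :
    ∃ g : NTop.RefinementMorphism V NTop.SigmaR,
      ∀ x : NTop.Point V, NTop.Point.Equiv (f x) (NTop.SigmaR.toNatReal (g.onPoints x)) := by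
  have hfin := hV.trea.finite_predecessors
  have hF : Continuous (NTop.NatReal.val ∘ f) := NTop.NatReal.continuous_val.comp hf
  have hval : ∀ (p : NTop.Point V) (h : NTop.IsPoint fun n => NTop.approx (NTop.NatReal.val ∘ f) (p.1 n)),
      NTop.NatReal.val (NTop.SigmaR.toNatReal ⟨_, h⟩) = NTop.NatReal.val (f p) :=
    fun p h => NTop.NatReal.val_eq_of_mem fun n => NTop.mem_carrier_approx (NTop.NatReal.val ∘ f) (p.mem_hat n)
  refine ⟨⟨NTop.approx (NTop.NatReal.val ∘ f), NTop.isPoint_approx hfin hF, fun p q hpq => ?_,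
    fun a b h => NTop.approx_mono _ hfin h⟩, fun x hx => ?_⟩
  -- Apart images have different values, and by `hval` these are the values of `F` at `p` and `q`.
  · refine NTop.Point.apart_of_ne hF ?_
    have hne := NTop.NatReal.apart_iff_val_ne.1
      (show NTop.Point.Apart (NTop.SigmaR.toNatReal _) (NTop.SigmaR.toNatReal _) from hpq)
    rwa [hval, hval] at hne
  · exact NTop.NatReal.apart_iff_val_ne.1 hx (hval x _).symm
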